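/- Let $n,M\in\mathbb N$ with $n\ge 1$, let $\Omega\subset\mathbb R^n$ be a domain (a connected open set), and let $u=(u_1,\dots,u_M)\in H^1_{loc}(\Omega;\mathbb R^M)$, i.e. each $u_k$ and its first order weak partial derivatives $\partial_{x_j}u_k$ are in $L^2_{loc}(\Omega)$. Write $|\nabla u|=\big(\sum_{j=1}^n\sum_{k=1}^M|\partial_{x_j}u_k|^2\big)^{1/2}$ and $|u|=\big(\sum_{k=1}^M|u_k|^2\big)^{1/2}$. Suppose that for some constant $C>0$ $$|\nabla u(x)|\le \frac{C}{|x|}\,|u(x)|\qquad\text{for a.e. }x\in\Omega .$$ Let $x_0\in\Omega$; if $n=1$ and $0\in\Omega$, assume moreover that $x_0=0$. If $u$ vanishes to infinite order at $x_0$ in the $L^2$ sense, i.e. $$\lim_{r\to0^+} r^{-m}\int_{|x-x_0|<r}|u(x)|^2\,dx=0\qquad\text{for every integer } m\ge0,$$ then $u=0$ a.e. on $\Omega$. -/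

import Mathlib

open MeasureTheory Filter Topology Set
open scoped ENNReal ContDiff

/-- `f ∈ L^p_loc(Ω)`: `f` is in `L^p(K)` for every compact `K ⊆ Ω`. -/
def MemLpLoc {n : ℕ} {F : Type*} [NormedAddCommGroup F] (f : EuclideanSpace ℝ (Fin n) → F)
    (p : ℝ≥0∞) (Ω : Set (EuclideanSpace ℝ (Fin n))) : Prop :=
  ∀ K : Set (EuclideanSpace ℝ (Fin n)), K ⊆ Ω → IsCompact K → MemLp f p (volume.restrict K)

/-- `g` is the weak (distributional) partial derivative `∂f/∂x_j` on the open set `Ω`: both functions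
are locally integrable on `Ω`, and `∫_Ω f ∂_j φ = - ∫_Ω g φ` for all `φ ∈ C_c^∞(Ω)`. -/
def HasWeakPartialDeriv {n : ℕ} (Ω : Set (EuclideanSpace ℝ (Fin n))) (j : Fin n)
    (f g : EuclideanSpace ℝ (Fin n) → ℝ) : Prop :=
  MemLpLoc f 1 Ω ∧ MemLpLoc g 1 Ω ∧
    ∀ φ : EuclideanSpace ℝ (Fin n) → ℝ, ContDiff ℝ ∞ φ → HasCompactSupport φ → tsupport φ ⊆ Ω →
      ∫ x in Ω, f x * fderiv ℝ φ x (EuclideanSpace.single j 1) = - ∫ x in Ω, g x * φ x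

/-- `f ∈ W^{1,p}_loc(Ω)`: `f ∈ L^p_loc(Ω)`, and its first order weak partial derivatives exist and
are in `L^p_loc(Ω)`. -/
def MemW1pLoc {n : ℕ} (f : EuclideanSpace ℝ (Fin n) → ℝ) (p : ℝ≥0∞)
    (Ω : Set (EuclideanSpace ℝ (Fin n))) : Prop :=
  MemLpLoc f p Ω ∧
    ∀ j : Fin n, ∃ g : EuclideanSpace ℝ (Fin n) → ℝ, HasWeakPartialDeriv Ω j f g ∧ MemLpLoc g p Ω

/-- `u ∈ H^1_loc(Ω; ℝ^M)`: every component of `u` is in `W^{1,2}_loc(Ω)`. -/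
def MemH1Loc {n M : ℕ} (u : EuclideanSpace ℝ (Fin n) → EuclideanSpace ℝ (Fin M))
    (Ω : Set (EuclideanSpace ℝ (Fin n))) : Prop :=
  ∀ k : Fin M, MemW1pLoc (fun x => u x k) 2 Ω

/-- `Du` is the weak gradient (Jacobian matrix) of `u` on `Ω`: its entry `Du x k j` is the weak
derivative `∂u_k/∂x_j`. -/
def HasWeakGradient {n M : ℕ} (Ω : Set (EuclideanSpace ℝ (Fin n)))
    (u : EuclideanSpace ℝ (Fin n) → EuclideanSpace ℝ (Fin M))
    (Du : EuclideanSpace ℝ (Fin n) → Matrix (Fin M) (Fin n) ℝ) : Prop :=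
  ∀ (k : Fin M) (j : Fin n), HasWeakPartialDeriv Ω j (fun x => u x k) (fun x => Du x k j)

/-- The norm `|A| = (∑_j ∑_k |A_kj|²)^{1/2}` of a gradient matrix. -/
noncomputable def gradientNorm {n M : ℕ} (A : Matrix (Fin M) (Fin n) ℝ) : ℝ :=
  Real.sqrt (∑ j : Fin n, ∑ k : Fin M, |A k j| ^ 2)

/-- `u` vanishes to infinite order (is flat) at `x₀` in the `L²` sense:
`r^{-m} ∫_{|x - x₀| < r} |u|² → 0` as `r → 0⁺`, for all `m`. (For `u ∈ L²_loc(Ω)` and `x₀ ∈ Ω`, `Ω`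
open, only the values of `u` on `Ω` matter, and the integrals are finite for small `r`.) -/
def VanishesToInfiniteOrder {n M : ℕ} (u : EuclideanSpace ℝ (Fin n) → EuclideanSpace ℝ (Fin M))
    (x₀ : EuclideanSpace ℝ (Fin n)) : Prop :=
  ∀ m : ℕ, Tendsto (fun r : ℝ => (r ^ m)⁻¹ * ∫ x in Metric.ball x₀ r, ‖u x‖ ^ 2) (𝓝[>] 0) (𝓝 0)

/-! Put f = |u|². Its weak gradient is 2 ∑ u_k ∇u_k (`HasWeakPartialDeriv.integral_sq`), so on a
ball about z where |x - z| ≤ |x|, Cauchy–Schwarz and the hypothesis give (x - z)·∇f ≤ 2C f: along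
rays from z, f grows at most like a power. For a bump η the averages I(t) = ∫ f η((x - z)/t) then
satisfy t I' ≤ (n + 2C) I, so I(t)/t^m is nonincreasing for m ≥ n + 2C. If f is flat at z, this
quotient tends to 0 as t → 0⁺; hence I = 0 and u = 0 near z (`ae_eq_zero_of_radial_derivative_le`).
No Carleman estimate is involved.

Let N be the set of points near which u vanishes (`locallyNullSet`). It is open and contains x₀.
Near a point x ≠ 0 of Ω the argument works on balls of a fixed radius about all nearby centres, so N
is closed in Ω \ {0}. At 0, if n ≥ 2, a punctured ball is connected, so N contains all of it once it
meets it, and the centre has measure zero. If n = 1 a punctured interval is disconnected (max(x, 0)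
is a counterexample), but then x₀ = 0 is already in N. Connectedness of Ω finishes the proof. -/

/-! ### Mollification, weak derivative of a square, uniqueness of weak derivatives -/

/-- The correlation of two `L²` functions is continuous. -/
theorem continuous_integral_mul_sub {n : ℕ} {p q : EuclideanSpace ℝ (Fin n) → ℝ}
    (hp : MemLp p 2 volume) (hq : MemLp q 2 volume) :
    Continuous fun y => ∫ x, p x * q (x - y) := by
  have : Fact ((2 : ℝ≥0∞) ≠ ⊤) := ⟨by simp⟩
  -- The correlation is the `L²` inner product of p with a translate of q, and translation acts
  -- continuously on `L²`.
  have h1 : Continuous fun y : EuclideanSpace ℝ (Fin n) =>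
      inner ℝ (hp.toLp p) (DomAddAct.mk (-y) +ᵥ hq.toLp q) := by
    refine continuous_const.inner ?_
    have h2 : Continuous fun y : EuclideanSpace ℝ (Fin n) => DomAddAct.mk (-y) :=
      DomAddAct.continuous_mk.comp continuous_neg
    exact h2.vadd continuous_const
  refine h1.congr fun y => ?_
  rw [L2.inner_def, DomAddAct.mk_vadd_toLp]
  refine integral_congr_ae ?_
  filter_upwards [hp.coeFn_toLp, MemLp.coeFn_toLp (hq.comp_measurePreserving
    (measurePreserving_vadd (-y) (volume : Measure (EuclideanSpace ℝ (Fin n)))))] with x h3 h4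
  have h5 : -y + x = x - y := by abel
  refine (congrArg₂ (inner ℝ) h3 h4).trans ?_
  simp only [Function.comp_apply, vadd_eq_add, h5]
  simp [mul_comm]

theorem MeasureTheory.MemLp.comp_sub_right_two {n : ℕ} {q : EuclideanSpace ℝ (Fin n) → ℝ}
    (hq : MemLp q 2 volume) (y : EuclideanSpace ℝ (Fin n)) :
    MemLp (fun x => q (x - y)) 2 volume :=
  hq.comp_measurePreserving (measurePreserving_sub_right volume y)

open scoped Convolution in
/-- Mollifications of an `L²` function converge weakly in `L²`. -/
theorem tendsto_integral_mul_convolution {n : ℕ} {p q : EuclideanSpace ℝ (Fin n) → ℝ}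
    (hp : MemLp p 2 volume) (hq : MemLp q 2 volume)
    {ρ : ℕ → ContDiffBump (0 : EuclideanSpace ℝ (Fin n))}
    (hρ : Tendsto (fun i => (ρ i).rOut) atTop (𝓝 0)) :
    Tendsto (fun i => ∫ x, p x * (q ⋆[ContinuousLinearMap.lsmul ℝ ℝ, volume]
      (ρ i).normed volume) x) atTop (𝓝 (∫ x, p x * q x)) := by
  -- By Fubini, pairing p with a mollification of q is the mollification at 0 of the continuous
  -- correlation function, which tends to its value at 0.
  have hc := continuous_integral_mul_sub hp hq
  have h1 := ContDiffBump.convolution_tendsto_right_of_continuous (μ := volume) hρ hc 0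
  rw [show (∫ x, p x * q x) = ∫ x, p x * q (x - 0) by simp]
  refine h1.congr fun i => ?_
  have hneg : ∀ y, (ρ i).normed volume (-y) = (ρ i).normed volume y := (ρ i).normed_neg
  have hcpt : HasCompactSupport ((ρ i).normed (volume : Measure (EuclideanSpace ℝ (Fin n)))) :=
    (ρ i).hasCompactSupport_normed
  have hcont : Continuous ((ρ i).normed (volume : Measure (EuclideanSpace ℝ (Fin n)))) :=
    (ρ i).continuous_normed
  have hint : Integrable (Function.uncurry fun x y : EuclideanSpace ℝ (Fin n) =>
      p x * (q (x - y) * (ρ i).normed volume y)) (volume.prod volume) := by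
    have hm : AEStronglyMeasurable (Function.uncurry fun x y : EuclideanSpace ℝ (Fin n) =>
        p x * (q (x - y) * (ρ i).normed volume y)) (volume.prod volume) := by
      refine (hp.1.comp_fst).mul (AEStronglyMeasurable.mul ?_
        (hcont.aestronglyMeasurable.comp_snd))
      exact hq.1.comp_quasiMeasurePreserving (quasiMeasurePreserving_sub_of_right_invariant _ _)
    rw [integrable_prod_iff' hm]
    constructor
    · refine Eventually.of_forall fun y => ?_
      have := (MemLp.integrable_mul hp (hq.comp_sub_right_two y)).mul_const
        ((ρ i).normed volume y)
      simpa [Function.uncurry, mul_assoc] using this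
    · have h2 := continuous_integral_mul_sub hp.norm hq.norm
      have h3 : Integrable fun y => (∫ x, ‖p x‖ * ‖q (x - y)‖) * (ρ i).normed volume y :=
        (h2.mul hcont).integrable_of_hasCompactSupport hcpt.mul_left
      refine h3.congr (Eventually.of_forall fun y => ?_)
      simp only [Function.uncurry, norm_mul]
      rw [← integral_mul_const]
      refine integral_congr_ae (Eventually.of_forall fun x => ?_)
      simp only [Real.norm_of_nonneg ((ρ i).nonneg_normed y)]
      ring
  calc _ = ∫ y, ∫ x, p x * (q (x - y) * (ρ i).normed volume y) := by
        rw [convolution_def]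
        rw [← integral_neg_eq_self]
        refine integral_congr_ae (Eventually.of_forall fun y => ?_)
        simp only [ContinuousLinearMap.lsmul_apply, smul_eq_mul, hneg, zero_sub, neg_neg]
        rw [← integral_const_mul]
        refine integral_congr_ae (Eventually.of_forall fun x => ?_)
        simp only
        ring
    _ = ∫ x, ∫ y, p x * (q (x - y) * (ρ i).normed volume y) :=
        (integral_integral_swap hint).symm
    _ = _ := by
        refine integral_congr_ae (Eventually.of_forall fun x => ?_)
        simp only
        rw [integral_const_mul, convolution_eq_swap]
        simp

-- Only one of the two factors w is mollified: with W = w ⋆ ρ smooth, Wφ is an admissible test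
-- function, and each term of the resulting identity pairs a fixed `L²` function with a
-- mollification, so weak convergence suffices for the limit.
open scoped Convolution in
theorem integral_sq_mul_fderiv_eq {n : ℕ} {w w' : EuclideanSpace ℝ (Fin n) → ℝ}
    (hw : MemLp w 2 volume) (hw' : MemLp w' 2 volume) (e : EuclideanSpace ℝ (Fin n))
    (h : ∀ ψ : EuclideanSpace ℝ (Fin n) → ℝ, ContDiff ℝ ∞ ψ → HasCompactSupport ψ →
      ∫ x, w x * fderiv ℝ ψ x e = - ∫ x, w' x * ψ x)
    {φ : EuclideanSpace ℝ (Fin n) → ℝ} (hφ : ContDiff ℝ ∞ φ) (hφc : HasCompactSupport φ) :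
    ∫ x, w x ^ 2 * fderiv ℝ φ x e = - ∫ x, (2 * w x * w' x) * φ x := by
  let ρ : ℕ → ContDiffBump (0 : EuclideanSpace ℝ (Fin n)) := fun i =>
    ⟨1 / (i + 1) / 2, 1 / (i + 1), by positivity, half_lt_self (by positivity)⟩
  have hρ : Tendsto (fun i => (ρ i).rOut) atTop (𝓝 0) := tendsto_one_div_add_atTop_nhds_zero_nat
  have hwl : LocallyIntegrable w volume := hw.locallyIntegrable (by norm_num)
  have hwl' : LocallyIntegrable w' volume := hw'.locallyIntegrable (by norm_num)
  have hφ' : Continuous fun x => fderiv ℝ φ x e :=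
    (hφ.continuous_fderiv (by simp)).clm_apply continuous_const
  have hφc' : HasCompactSupport fun x => fderiv ℝ φ x e := hφc.fderiv_apply ℝ e
  have hbd : ∀ {a b : EuclideanSpace ℝ (Fin n) → ℝ}, MemLp a 2 volume → Continuous b →
      HasCompactSupport b → MemLp (fun x => a x * b x) 2 volume := by
    intro a b ha hb hbc
    have hb' : MemLp b ⊤ volume := hb.memLp_of_hasCompactSupport hbc
    have := MemLp.mul (p := 2) (q := ⊤) (r := 2) hb' ha
    simpa [Pi.mul_def, mul_comm] using this
  have h1 := hbd hw hφ' hφc'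
  have h2 := hbd hw hφ.continuous hφc
  have h3 := hbd hw' hφ.continuous hφc
  have key : ∀ i, (∫ x, (w x * fderiv ℝ φ x e) *
        (w ⋆[ContinuousLinearMap.lsmul ℝ ℝ, volume] (ρ i).normed volume) x) +
      (∫ x, (w x * φ x) *
        (w' ⋆[ContinuousLinearMap.lsmul ℝ ℝ, volume] (ρ i).normed volume) x) =
      - ∫ x, (w' x * φ x) *
        (w ⋆[ContinuousLinearMap.lsmul ℝ ℝ, volume] (ρ i).normed volume) x := by
    intro i
    set r := (ρ i).normed (volume : Measure (EuclideanSpace ℝ (Fin n))) with hr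
    have hrc : HasCompactSupport r := (ρ i).hasCompactSupport_normed
    have hrs : ContDiff ℝ ∞ r := (ρ i).contDiff_normed
    set W := (w ⋆[ContinuousLinearMap.lsmul ℝ ℝ, volume] r) with hW
    set W' := (w' ⋆[ContinuousLinearMap.lsmul ℝ ℝ, volume] r) with hW'
    have hWs : ContDiff ℝ ∞ W := hrc.contDiff_convolution_right _ hwl hrs
    have hWs' : ContDiff ℝ ∞ W' := hrc.contDiff_convolution_right _ hwl' hrs
    -- Mollification commutes with the weak derivative: test the hypothesis with y ↦ r (x - y).
    have hder : ∀ x, fderiv ℝ W x e = W' x := by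
      intro x
      rw [(hrc.hasFDerivAt_convolution_right (ContinuousLinearMap.lsmul ℝ ℝ) hwl
        (hrs.of_le (by simp)) x).fderiv,
        convolution_precompR_apply _ hwl (hrc.fderiv ℝ) (hrs.continuous_fderiv (by simp))]
      have h4 := h (fun y => r (x - y)) (hrs.comp (contDiff_const.sub contDiff_id))
        (hrc.comp_homeomorph (Homeomorph.subLeft x))
      have h5 : ∀ y, fderiv ℝ (fun y => r (x - y)) y e = - fderiv ℝ r (x - y) e := by
        intro y
        have h6 : HasFDerivAt (fun y => r (x - y))
            ((fderiv ℝ r (x - y)).comp (-ContinuousLinearMap.id ℝ _)) y :=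
          ((hrs.differentiable (by simp)) (x - y)).hasFDerivAt.comp y
            ((hasFDerivAt_id y).const_sub x)
        rw [h6.fderiv]; simp
      simp only [h5, mul_neg, integral_neg, neg_inj] at h4
      simpa [convolution_def, hW'] using h4
    have h4 := h (fun x => W x * φ x) (hWs.mul hφ) hφc.mul_left
    have h5 : ∀ x, w x * fderiv ℝ (fun x => W x * φ x) x e =
        (w x * fderiv ℝ φ x e) * W x + (w x * φ x) * W' x := by
      intro x
      rw [fderiv_fun_mul (hWs.differentiable (by simp) x) (hφ.differentiable (by simp) x)]
      simp [hder]; ring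
    simp only [h5] at h4
    rw [integral_add] at h4
    · rw [h4]; congr 1
      exact integral_congr_ae (Eventually.of_forall fun x => by simp only; ring)
    · have := hwl.integrable_smul_right_of_hasCompactSupport (hφ'.mul hWs.continuous) hφc'.mul_right
      refine this.congr (Eventually.of_forall fun x => ?_)
      simp [mul_assoc]
    · have := hwl.integrable_smul_right_of_hasCompactSupport (hφ.continuous.mul hWs'.continuous)
        hφc.mul_right
      refine this.congr (Eventually.of_forall fun x => ?_)
      simp [mul_assoc]
  have l1 := tendsto_integral_mul_convolution h1 hw hρ
  have l2 := tendsto_integral_mul_convolution h2 hw' hρ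
  have l3 := tendsto_integral_mul_convolution h3 hw hρ
  have l4 := tendsto_nhds_unique (l1.add l2) (l3.neg.congr fun i => (key i).symm)
  have i1 : ∫ x, w x ^ 2 * fderiv ℝ φ x e = ∫ x, w x * fderiv ℝ φ x e * w x :=
    integral_congr_ae (Eventually.of_forall fun x => by simp only; ring)
  have i2 : ∫ x, (2 * w x * w' x) * φ x = (∫ x, w x * φ x * w' x) + ∫ x, w' x * φ x * w x := by
    have j1 : Integrable fun x => w x * φ x * w' x := MemLp.integrable_mul h2 hw'
    have j2 : Integrable fun x => w' x * φ x * w x := MemLp.integrable_mul h3 hw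
    rw [← integral_add j1 j2]
    exact integral_congr_ae (Eventually.of_forall fun x => by simp only; ring)
  rw [i1, i2]; linarith

theorem MemLpLoc.mul_of_tsupport_subset {n : ℕ} {Ω : Set (EuclideanSpace ℝ (Fin n))} {p : ℝ≥0∞}
    {a b : EuclideanSpace ℝ (Fin n) → ℝ} (ha : MemLpLoc a p Ω) (hb : Continuous b)
    (hbc : HasCompactSupport b) (hbΩ : tsupport b ⊆ Ω) :
    MemLp (fun x => b x * a x) p volume := by
  have h1 : MemLp (fun x => b x * a x) p (volume.restrict (tsupport b)) :=
    MemLp.mul (p := ⊤) (q := p) (r := p) (ha _ hbΩ hbc)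
      (hb.memLp_top_of_hasCompactSupport hbc _)
  have h2 := (memLp_indicator_iff_restrict (isClosed_tsupport b).measurableSet).2 h1
  refine (memLp_congr_ae (Eventually.of_forall fun x => ?_)).1 h2
  by_cases hx : x ∈ tsupport b
  · simp [hx]
  · simp [hx, image_eq_zero_of_notMem_tsupport hx]

theorem IsCompact.exists_contDiff_one_nhds {n : ℕ} {K Ω : Set (EuclideanSpace ℝ (Fin n))}
    (hK : IsCompact K) (hΩ : IsOpen Ω) (hKΩ : K ⊆ Ω) :
    ∃ χ : EuclideanSpace ℝ (Fin n) → ℝ, ContDiff ℝ ∞ χ ∧ HasCompactSupport χ ∧ tsupport χ ⊆ Ω ∧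
      ∀ x ∈ K, χ =ᶠ[𝓝 x] fun _ => 1 := by
  obtain ⟨L, hL, hKL, hLΩ⟩ := exists_compact_between hK hΩ hKΩ
  obtain ⟨χ, h1, h0, -⟩ := exists_contMDiffMap_one_nhds_of_subset_interior
    (modelWithCornersSelf ℝ (EuclideanSpace ℝ (Fin n))) (n := ⊤) hK.isClosed hKL
  have hsupp : tsupport χ ⊆ L := by
    refine closure_minimal (fun x hx => ?_) hL.isClosed
    by_contra hxL
    exact hx (h0 x hxL)
  refine ⟨χ, χ.contMDiff.contDiff, hL.of_isClosed_subset (isClosed_tsupport _) hsupp,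
    hsupp.trans hLΩ, fun x hx => ?_⟩
  exact eventually_nhdsSet_iff_forall.1 h1 x hx

/-- The square of a function in `H¹_loc` has the weak derivative given by the product rule. -/
theorem HasWeakPartialDeriv.integral_sq {n : ℕ} {Ω : Set (EuclideanSpace ℝ (Fin n))}
    (hΩ : IsOpen Ω) {j : Fin n} {a a' : EuclideanSpace ℝ (Fin n) → ℝ}
    (h : HasWeakPartialDeriv Ω j a a') (ha : MemLpLoc a 2 Ω) (ha' : MemLpLoc a' 2 Ω)
    {φ : EuclideanSpace ℝ (Fin n) → ℝ} (hφ : ContDiff ℝ ∞ φ) (hφc : HasCompactSupport φ)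
    (hφΩ : tsupport φ ⊆ Ω) :
    ∫ x in Ω, a x ^ 2 * fderiv ℝ φ x (EuclideanSpace.single j 1) =
      - ∫ x in Ω, (2 * a x * a' x) * φ x := by
  obtain ⟨χ, hχ, hχc, hχΩ, hχ1⟩ := hφc.isCompact.exists_contDiff_one_nhds hΩ hφΩ
  set e : EuclideanSpace ℝ (Fin n) := EuclideanSpace.single j 1
  have hsub : tsupport (fun x => fderiv ℝ χ x e) ⊆ tsupport χ := tsupport_fderiv_apply_subset ℝ e
  have hχ' : Continuous fun x => fderiv ℝ χ x e :=
    (hχ.continuous_fderiv (by simp)).clm_apply continuous_const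
  have hχc' : HasCompactSupport fun x => fderiv ℝ χ x e := hχc.fderiv_apply ℝ e
  have hm1 := ha.mul_of_tsupport_subset hχ.continuous hχc hχΩ
  have hm2 := ha'.mul_of_tsupport_subset hχ.continuous hχc hχΩ
  have hm3 := ha.mul_of_tsupport_subset hχ' hχc' (hsub.trans hχΩ)
  have hz : ∀ x ∉ Ω, χ x = 0 := fun x hx =>
    image_eq_zero_of_notMem_tsupport fun hx' => hx (hχΩ hx')
  have hz' : ∀ x ∉ Ω, fderiv ℝ χ x e = 0 := fun x hx =>
    image_eq_zero_of_notMem_tsupport (f := fun x => fderiv ℝ χ x e) fun hx' =>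
      hx (hχΩ (hsub hx'))
  have hφz : ∀ x ∉ tsupport φ, fderiv ℝ φ x e = 0 := fun x hx =>
    image_eq_zero_of_notMem_tsupport (f := fun x => fderiv ℝ φ x e) fun hx' =>
      hx (tsupport_fderiv_apply_subset ℝ e hx')
  -- The cut-off function χa is in `L²` of the whole space, with weak derivative χa' + (∂χ)a. Since
  -- χ = 1 near the support of φ, the global identity for χa restricts to the one for a.
  have hglob : ∀ ψ : EuclideanSpace ℝ (Fin n) → ℝ, ContDiff ℝ ∞ ψ → HasCompactSupport ψ →
      ∫ x, (χ x * a x) * fderiv ℝ ψ x e =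
        - ∫ x, (χ x * a' x + fderiv ℝ χ x e * a x) * ψ x := by
    intro ψ hψ hψc
    have hψ2 : MemLp ψ 2 volume := hψ.continuous.memLp_of_hasCompactSupport hψc
    have hψ2' : MemLp (fun x => fderiv ℝ ψ x e) 2 volume :=
      ((hψ.continuous_fderiv (by simp)).clm_apply continuous_const).memLp_of_hasCompactSupport
        (hψc.fderiv_apply ℝ e)
    have i1 : Integrable fun x => (χ x * a x) * fderiv ℝ ψ x e := hm1.integrable_mul hψ2'
    have i2 : Integrable fun x => (χ x * a' x) * ψ x := hm2.integrable_mul hψ2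
    have i3 : Integrable fun x => (fderiv ℝ χ x e * a x) * ψ x := hm3.integrable_mul hψ2
    have h1 := h.2.2 (fun x => χ x * ψ x) (hχ.mul hψ) hχc.mul_right
      ((tsupport_mul_subset_left).trans hχΩ)
    rw [setIntegral_eq_integral_of_forall_compl_eq_zero,
      setIntegral_eq_integral_of_forall_compl_eq_zero] at h1
    · have h2 : ∀ x, a x * fderiv ℝ (fun x => χ x * ψ x) x e =
          (χ x * a x) * fderiv ℝ ψ x e + (fderiv ℝ χ x e * a x) * ψ x := by
        intro x
        rw [fderiv_fun_mul (hχ.differentiable (by simp) x) (hψ.differentiable (by simp) x)]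
        simp; ring
      have h3 : ∀ x, a' x * (χ x * ψ x) = (χ x * a' x) * ψ x := fun x => by ring
      change ∫ x, a x * fderiv ℝ (fun x => χ x * ψ x) x e = _ at h1
      simp only [h2, h3] at h1
      rw [integral_add i1 i3] at h1
      simp only [add_mul]
      rw [integral_add i2 i3]
      linarith
    · intro x hx
      simp [hz x hx]
    · intro x hx
      change a x * fderiv ℝ (fun x => χ x * ψ x) x e = 0
      rw [fderiv_fun_mul (hχ.differentiable (by simp) x) (hψ.differentiable (by simp) x)]
      simp [hz x hx, hz' x hx]
  have key := integral_sq_mul_fderiv_eq hm1 (hm2.add hm3) e hglob hφ hφc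
  rw [setIntegral_eq_integral_of_forall_compl_eq_zero,
    setIntegral_eq_integral_of_forall_compl_eq_zero]
  · convert key using 2
    · ext x
      by_cases hx : x ∈ tsupport φ
      · simp [(hχ1 x hx).eq_of_nhds]
      · simp [hφz x hx]
    · congr 1
      ext x
      by_cases hx : x ∈ tsupport φ
      · simp [(hχ1 x hx).eq_of_nhds, (hχ1 x hx).fderiv_eq]
      · simp [image_eq_zero_of_notMem_tsupport hx]
  · intro x hx
    simp [image_eq_zero_of_notMem_tsupport fun hx' => hx (hφΩ hx')]
  · intro x hx
    simp [hφz x fun hx' => hx (hφΩ hx')]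

/-- Weak derivatives are unique almost everywhere. -/
theorem HasWeakPartialDeriv.ae_eq {n : ℕ} {Ω : Set (EuclideanSpace ℝ (Fin n))}
    (hΩ : IsOpen Ω) {j : Fin n} {a b c : EuclideanSpace ℝ (Fin n) → ℝ}
    (hb : HasWeakPartialDeriv Ω j a b) (hc : HasWeakPartialDeriv Ω j a c) :
    b =ᵐ[volume.restrict Ω] c := by
  have hloc : ∀ {f : EuclideanSpace ℝ (Fin n) → ℝ}, MemLpLoc f 1 Ω →
      LocallyIntegrableOn f Ω volume := fun hf =>
    (locallyIntegrableOn_iff hΩ.isLocallyClosed).2 fun K hK hKc =>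
      memLp_one_iff_integrable.1 (hf K hK hKc)
  have h := hΩ.ae_eq_zero_of_integral_contDiff_smul_eq_zero (μ := volume) (f := b - c)
    ((hloc hb.2.1).sub (hloc hc.2.1)) fun φ hφ hφc hφΩ => by
      have h1 := hb.2.2 φ hφ hφc hφΩ
      rw [hc.2.2 φ hφ hφc hφΩ, neg_inj,
        setIntegral_eq_integral_of_forall_compl_eq_zero fun x hx => by
          simp [image_eq_zero_of_notMem_tsupport fun hx' => hx (hφΩ hx')],
        setIntegral_eq_integral_of_forall_compl_eq_zero fun x hx => by
          simp [image_eq_zero_of_notMem_tsupport fun hx' => hx (hφΩ hx')]] at h1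
      have hi : ∀ {f : EuclideanSpace ℝ (Fin n) → ℝ}, MemLpLoc f 1 Ω →
          Integrable fun x => φ x * f x := fun hf =>
        memLp_one_iff_integrable.1 (hf.mul_of_tsupport_subset hφ.continuous hφc hφΩ)
      simp only [Pi.sub_apply, smul_eq_mul, mul_sub]
      rw [integral_sub (hi hb.2.1) (hi hc.2.1)]
      simp only [mul_comm (φ _)]
      linarith
  rw [EventuallyEq, ae_restrict_iff' hΩ.measurableSet]
  filter_upwards [h] with x hx hxΩ
  exact sub_eq_zero.1 (hx hxΩ)

/-! ### Dilated cut-offs and the radial growth estimate -/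

theorem MeasureTheory.IntegrableOn.mul_of_hasCompactSupport {n : ℕ}
    {B : Set (EuclideanSpace ℝ (Fin n))} {F b : EuclideanSpace ℝ (Fin n) → ℝ}
    (hF : IntegrableOn F B) (hb : Continuous b) (hbc : HasCompactSupport b) :
    IntegrableOn (fun x => F x * b x) B := by
  obtain ⟨c, hc⟩ := hb.bounded_above_of_compact_support hbc
  exact Integrable.mul_bdd hF hb.aestronglyMeasurable (Eventually.of_forall hc)

theorem HasCompactSupport.comp_dilation {n : ℕ} {b : EuclideanSpace ℝ (Fin n) → ℝ}
    (hb : HasCompactSupport b) (z : EuclideanSpace ℝ (Fin n)) {t : ℝ} (ht : 0 < t) :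
    HasCompactSupport fun x => b (t⁻¹ • (x - z)) :=
  (hb.comp_homeomorph (Homeomorph.smulOfNeZero t⁻¹ (inv_ne_zero ht.ne'))).comp_homeomorph
    (Homeomorph.subRight z)

theorem continuous_fderiv_apply_self {n : ℕ} {η : EuclideanSpace ℝ (Fin n) → ℝ}
    (hη : ContDiff ℝ ∞ η) : Continuous fun y => fderiv ℝ η y y :=
  (hη.continuous_fderiv (by simp)).clm_apply continuous_id

theorem HasCompactSupport.fderiv_apply_self {n : ℕ} {η : EuclideanSpace ℝ (Fin n) → ℝ}
    (hηc : HasCompactSupport η) : HasCompactSupport fun y => fderiv ℝ η y y := by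
  refine HasCompactSupport.intro' (K := tsupport η) hηc (isClosed_tsupport _) fun x hx => ?_
  have : fderiv ℝ η x = 0 := image_eq_zero_of_notMem_tsupport (f := fderiv ℝ η) fun hx' =>
    hx (tsupport_fderiv_subset ℝ hx')
  simp [this]

theorem hasDerivAt_dilation {n : ℕ} {η : EuclideanSpace ℝ (Fin n) → ℝ}
    (hη : ContDiff ℝ ∞ η) (v : EuclideanSpace ℝ (Fin n)) {t : ℝ} (ht : 0 < t) :
    HasDerivAt (fun t : ℝ => η (t⁻¹ • v)) (-t⁻¹ * fderiv ℝ η (t⁻¹ • v) (t⁻¹ • v)) t := by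
  have h1 : HasDerivAt (fun t : ℝ => t⁻¹ • v) ((-(t ^ 2)⁻¹) • v) t :=
    (hasDerivAt_inv ht.ne').smul_const _
  have h2 := ((hη.differentiable (by simp)) (t⁻¹ • v)).hasFDerivAt.comp_hasDerivAt t h1
  refine HasDerivAt.congr_deriv h2 ?_
  rw [map_smul, map_smul, smul_eq_mul, smul_eq_mul]
  field_simp

theorem fderiv_dilation_apply {n : ℕ} {η : EuclideanSpace ℝ (Fin n) → ℝ}
    (hη : ContDiff ℝ ∞ η) (z x v : EuclideanSpace ℝ (Fin n)) (t : ℝ) :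
    fderiv ℝ (fun x => η (t⁻¹ • (x - z))) x v = fderiv ℝ η (t⁻¹ • (x - z)) (t⁻¹ • v) := by
  have h1 : HasFDerivAt (fun x => η (t⁻¹ • (x - z))) ((fderiv ℝ η (t⁻¹ • (x - z))).comp
      (t⁻¹ • ContinuousLinearMap.id ℝ _)) x :=
    ((hη.differentiable (by simp)) _).hasFDerivAt.comp x
      (((hasFDerivAt_id x).sub_const z).const_smul t⁻¹)
  rw [h1.fderiv]; simp

theorem hasDerivAt_integral_dilation {n : ℕ} {B : Set (EuclideanSpace ℝ (Fin n))}
    {f η : EuclideanSpace ℝ (Fin n) → ℝ} (hf : IntegrableOn f B) (hη : ContDiff ℝ ∞ η)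
    (hηc : HasCompactSupport η) (z : EuclideanSpace ℝ (Fin n)) {t : ℝ} (ht : 0 < t) :
    HasDerivAt (fun t : ℝ => ∫ x in B, f x * η (t⁻¹ • (x - z)))
      (-t⁻¹ * ∫ x in B, f x * fderiv ℝ η (t⁻¹ • (x - z)) (t⁻¹ • (x - z))) t := by
  have hξ := continuous_fderiv_apply_self hη
  obtain ⟨M, hM⟩ := hξ.bounded_above_of_compact_support hηc.fderiv_apply_self
  have hc : ∀ t : ℝ, Continuous fun x : EuclideanSpace ℝ (Fin n) => t⁻¹ • (x - z) :=
    fun t => by fun_prop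
  rw [← integral_const_mul]
  have hm : AEStronglyMeasurable (fun x => f x *
      (-t⁻¹ * fderiv ℝ η (t⁻¹ • (x - z)) (t⁻¹ • (x - z)))) (volume.restrict B) :=
    hf.aestronglyMeasurable.mul
      (continuous_const.mul (hξ.comp (hc t))).aestronglyMeasurable
  have h1 := hasDerivAt_integral_of_dominated_loc_of_deriv_le (μ := volume.restrict B)
    (F := fun t x => f x * η (t⁻¹ • (x - z)))
    (F' := fun t x => f x * (-t⁻¹ * fderiv ℝ η (t⁻¹ • (x - z)) (t⁻¹ • (x - z))))
    (bound := fun x => ‖f x‖ * ((t / 2)⁻¹ * M)) (x₀ := t) (s := Ioi (t / 2))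
    (Ioi_mem_nhds (half_lt_self ht))
    (Eventually.of_forall fun s => hf.aestronglyMeasurable.mul
      (hη.continuous.comp (hc s)).aestronglyMeasurable)
    (hf.mul_of_hasCompactSupport (hη.continuous.comp (hc t)) (hηc.comp_dilation z ht))
    hm (Eventually.of_forall fun x s hs => ?_) (hf.norm.mul_const _)
    (Eventually.of_forall fun x s hs => ?_)
  · refine h1.2.congr_deriv (integral_congr_ae (Eventually.of_forall fun x => ?_))
    simp only
    ring
  -- Keeping s > t / 2 bounds the factor s⁻¹, which makes the dominating function independent of s.
  · have hs0 : 0 < s := (half_pos ht).trans hs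
    rw [norm_mul, norm_mul, norm_neg, norm_inv, Real.norm_of_nonneg hs0.le]
    refine mul_le_mul_of_nonneg_left ?_ (norm_nonneg _)
    exact mul_le_mul (inv_anti₀ (half_pos ht) (mem_Ioi.1 hs).le) (hM _) (norm_nonneg _)
      (inv_nonneg.2 (half_pos ht).le)
  · exact (hasDerivAt_dilation hη (x - z) ((half_pos ht).trans hs)).const_mul (f x)

/-- Testing a weak gradient with `h(x) (x - z)`. -/
theorem integral_radial_test {n : ℕ} {z : EuclideanSpace ℝ (Fin n)}
    {B : Set (EuclideanSpace ℝ (Fin n))}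
    {f h : EuclideanSpace ℝ (Fin n) → ℝ} {g : Fin n → EuclideanSpace ℝ (Fin n) → ℝ}
    (hf : IntegrableOn f B) (hg : ∀ j, IntegrableOn (g j) B)
    (hfg : ∀ j, ∀ φ : EuclideanSpace ℝ (Fin n) → ℝ, ContDiff ℝ ∞ φ → HasCompactSupport φ →
      tsupport φ ⊆ B → ∫ x in B, f x * fderiv ℝ φ x (EuclideanSpace.single j 1) =
        - ∫ x in B, g j x * φ x)
    (hh : ContDiff ℝ ∞ h) (hhc : HasCompactSupport h) (hhB : tsupport h ⊆ B) :
    n * (∫ x in B, f x * h x) + ∫ x in B, f x * fderiv ℝ h x (x - z) =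
      - ∫ x in B, (∑ j, (x j - z j) * g j x) * h x := by
  have hφ : ∀ j, ContDiff ℝ ∞ fun x : EuclideanSpace ℝ (Fin n) => (x j - z j) * h x :=
    fun j => ContDiff.mul (by fun_prop) hh
  have hgi : ∀ j, IntegrableOn (fun x => g j x * ((x j - z j) * h x)) B := fun j =>
    (hg j).mul_of_hasCompactSupport (hφ j).continuous hhc.mul_left
  have hDc : ∀ j, Continuous fun x => (x j - z j) *
      fderiv ℝ h x (EuclideanSpace.single j 1) := fun j =>
    Continuous.mul (by fun_prop) ((hh.continuous_fderiv (by simp)).clm_apply continuous_const)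
  have hDi : ∀ j, IntegrableOn (fun x => f x * ((x j - z j) *
      fderiv ℝ h x (EuclideanSpace.single j 1))) B := fun j =>
    hf.mul_of_hasCompactSupport (hDc j) (hhc.fderiv_apply ℝ _).mul_left
  have hfh : IntegrableOn (fun x => f x * h x) B :=
    hf.mul_of_hasCompactSupport hh.continuous hhc
  -- The test function is (x_j - z_j) h. Differentiating its first factor leaves one copy of ∫ f h
  -- for each j, whence the factor n after summation.
  have h1 : ∀ j, (∫ x in B, f x * h x) + ∫ x in B, f x * ((x j - z j) *
      fderiv ℝ h x (EuclideanSpace.single j 1)) =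
      - ∫ x in B, g j x * ((x j - z j) * h x) := by
    intro j
    rw [← hfg j _ (hφ j) hhc.mul_left (tsupport_mul_subset_right.trans hhB),
      ← integral_add hfh (hDi j)]
    refine integral_congr_ae (Eventually.of_forall fun x => ?_)
    have h2 : HasFDerivAt (fun x : EuclideanSpace ℝ (Fin n) => x j - z j)
        (EuclideanSpace.proj j : EuclideanSpace ℝ (Fin n) →L[ℝ] ℝ) x :=
      (EuclideanSpace.proj (𝕜 := ℝ) j).hasFDerivAt.sub_const _
    simp only
    rw [(h2.fun_mul (hh.differentiable (by simp) x).hasFDerivAt).fderiv]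
    simp; ring
  have h2 : ∀ x, f x * fderiv ℝ h x (x - z) = ∑ j, f x * ((x j - z j) *
      fderiv ℝ h x (EuclideanSpace.single j 1)) := by
    intro x
    rw [← Finset.mul_sum]
    congr 1
    conv_lhs => rw [← (EuclideanSpace.basisFun (Fin n) ℝ).sum_repr (x - z)]
    simp
  have h3 : ∀ x, (∑ j, (x j - z j) * g j x) * h x = ∑ j, g j x * ((x j - z j) * h x) := by
    intro x
    rw [Finset.sum_mul]
    exact Finset.sum_congr rfl fun j _ => by ring
  have h4 := Finset.sum_congr rfl fun j (_ : j ∈ Finset.univ) => h1 j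
  rw [Finset.sum_neg_distrib, Finset.sum_add_distrib] at h4
  simp only [h2, h3]
  rw [integral_finsetSum _ fun j _ => hDi j, integral_finsetSum _ fun j _ => hgi j, ← h4]
  simp

/-- A nonnegative function whose radial weak derivative about `z` is bounded by `A / |x - z|` times
itself, and which vanishes to infinite order at `z`, vanishes near `z`. -/
theorem ae_eq_zero_of_radial_derivative_le {n : ℕ} {z : EuclideanSpace ℝ (Fin n)} {R A : ℝ}
    {f : EuclideanSpace ℝ (Fin n) → ℝ} {g : Fin n → EuclideanSpace ℝ (Fin n) → ℝ}
    (hf : IntegrableOn f (Metric.ball z R)) (hg : ∀ j, IntegrableOn (g j) (Metric.ball z R))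
    (hf0 : ∀ x, 0 ≤ f x)
    (hfg : ∀ j, ∀ φ : EuclideanSpace ℝ (Fin n) → ℝ, ContDiff ℝ ∞ φ → HasCompactSupport φ →
      tsupport φ ⊆ Metric.ball z R →
      ∫ x in Metric.ball z R, f x * fderiv ℝ φ x (EuclideanSpace.single j 1) =
        - ∫ x in Metric.ball z R, g j x * φ x)
    (hA : ∀ᵐ x ∂(volume.restrict (Metric.ball z R)), ∑ j, (x j - z j) * g j x ≤ A * f x)
    (hflat : ∀ m : ℕ, Tendsto (fun r : ℝ => (r ^ m)⁻¹ * ∫ x in Metric.ball z r, f x)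
      (𝓝[>] 0) (𝓝 0))
    {T : ℝ} (hT0 : 0 < T) (hTR : T < R) :
    ∀ᵐ x ∂(volume.restrict (Metric.ball z (T / 2))), f x = 0 := by
  obtain ⟨η, hη, hηc, hη0, hη1, hηz, hηo⟩ : ∃ η : EuclideanSpace ℝ (Fin n) → ℝ,
      ContDiff ℝ ∞ η ∧ HasCompactSupport η ∧ (∀ y, 0 ≤ η y) ∧ (∀ y, η y ≤ 1) ∧
      (∀ y, 1 ≤ ‖y‖ → η y = 0) ∧ ∀ y, ‖y‖ ≤ 1 / 2 → η y = 1 := by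
    let η : ContDiffBump (0 : EuclideanSpace ℝ (Fin n)) :=
      ⟨1 / 2, 1, by norm_num, by norm_num⟩
    exact ⟨η, η.contDiff, η.hasCompactSupport, fun _ => η.nonneg, fun _ => η.le_one,
      fun y hy => η.zero_of_le_dist (by simpa using hy),
      fun y hy => η.one_of_mem_closedBall (mem_closedBall_zero_iff.2 hy)⟩
  set B := Metric.ball z R with hB
  have hnorm : ∀ t : ℝ, 0 < t → ∀ x : EuclideanSpace ℝ (Fin n), ‖t⁻¹ • (x - z)‖ = dist x z / t := by
    intro t ht x
    rw [norm_smul, norm_inv, Real.norm_of_nonneg ht.le, ← dist_eq_norm, inv_mul_eq_div]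
  have hhz : ∀ t : ℝ, 0 < t → ∀ x, t ≤ dist x z → η (t⁻¹ • (x - z)) = 0 := fun t ht x hx =>
    hηz _ (by rw [hnorm t ht]; exact (one_le_div₀ ht).2 hx)
  have hhts : ∀ t : ℝ, 0 < t → tsupport (fun x => η (t⁻¹ • (x - z))) ⊆ Metric.closedBall z t := by
    intro t ht
    refine closure_minimal (fun x hx => ?_) Metric.isClosed_closedBall
    by_contra hx'
    rw [Metric.mem_closedBall, not_le] at hx'
    exact hx (hhz t ht x hx'.le)
  have hh : ∀ t : ℝ, ContDiff ℝ ∞ fun x => η (t⁻¹ • (x - z)) := fun t =>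
    hη.comp ((contDiff_id.sub contDiff_const).const_smul t⁻¹)
  let I : ℝ → ℝ := fun t => ∫ x in B, f x * η (t⁻¹ • (x - z))
  have hfh : ∀ t : ℝ, 0 < t → IntegrableOn (fun x => f x * η (t⁻¹ • (x - z))) B := fun t ht =>
    hf.mul_of_hasCompactSupport (hh t).continuous (hηc.comp_dilation z ht)
  have hI0 : ∀ t, 0 ≤ I t := fun t => integral_nonneg fun x => mul_nonneg (hf0 x) (hη0 _)
  -- The left side is t I'(t): for a dilated bump, differentiation in t is radial differentiation up
  -- to the factor -1/t.
  have hkey : ∀ t : ℝ, 0 < t → t < R →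
      - ∫ x in B, f x * fderiv ℝ η (t⁻¹ • (x - z)) (t⁻¹ • (x - z)) ≤ (n + A) * I t := by
    intro t ht htR
    have h1 := integral_radial_test (z := z) hf hg hfg (hh t) (hηc.comp_dilation z ht)
      ((hhts t ht).trans (Metric.closedBall_subset_ball htR))
    simp only [fderiv_dilation_apply hη] at h1
    have h2 : ∫ x in B, (∑ j, (x j - z j) * g j x) * η (t⁻¹ • (x - z)) ≤ A * I t := by
      rw [← integral_const_mul]
      have hi : IntegrableOn (fun x => (∑ j, (x j - z j) * g j x) * η (t⁻¹ • (x - z))) B := by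
        have : ∀ j, IntegrableOn (fun x => g j x * ((x j - z j) * η (t⁻¹ • (x - z)))) B := by
          intro j
          refine (hg j).mul_of_hasCompactSupport ?_ (hηc.comp_dilation z ht).mul_left
          exact Continuous.mul (by fun_prop) (hh t).continuous
        refine (integrable_finsetSum Finset.univ fun j _ => this j).congr
          (Eventually.of_forall fun x => ?_)
        simp only [Finset.sum_mul]
        exact Finset.sum_congr rfl fun j _ => by ring
      refine integral_mono_ae hi ((hfh t ht).const_mul A) ?_
      filter_upwards [hA] with x hx
      simpa [mul_assoc] using mul_le_mul_of_nonneg_right hx (hη0 (t⁻¹ • (x - z)))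
    linarith
  -- An integer exponent is needed to match the flatness hypothesis; k + 1 ≥ n + A leaves harmless
  -- slack and avoids truncated subtraction in the derivative of the power.
  obtain ⟨k, hk⟩ := exists_nat_ge ((n : ℝ) + A)
  have hanti : AntitoneOn (fun t => I t / t ^ (k + 1)) (Ioo 0 R) := by
    have hd : ∀ t ∈ Ioo 0 R, HasDerivAt (fun t => I t / t ^ (k + 1))
        (((-t⁻¹ * ∫ x in B, f x * fderiv ℝ η (t⁻¹ • (x - z)) (t⁻¹ • (x - z))) * t ^ (k + 1) -
          I t * ((k + 1 : ℕ) * t ^ k)) / (t ^ (k + 1)) ^ 2) t := fun t ht =>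
      (hasDerivAt_integral_dilation hf hη hηc z ht.1).fun_div (hasDerivAt_pow (k + 1) t)
        (pow_pos ht.1 _).ne'
    refine antitoneOn_of_deriv_nonpos (convex_Ioo 0 R)
      (fun t ht => (hd t ht).continuousAt.continuousWithinAt) ?_ ?_
    · rw [interior_Ioo]
      exact fun t ht => (hd t ht).differentiableAt.differentiableWithinAt
    · rw [interior_Ioo]
      intro t ht
      rw [(hd t ht).deriv]
      have h1 := hkey t ht.1 ht.2
      generalize ∫ x in B, f x * fderiv ℝ η (t⁻¹ • (x - z)) (t⁻¹ • (x - z)) = J at h1 ⊢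
      have ht0 := ht.1
      refine div_nonpos_of_nonpos_of_nonneg ?_ (by positivity)
      have h2 : (n + A) * I t ≤ (k + 1) * I t :=
        mul_le_mul_of_nonneg_right (by linarith) (hI0 t)
      have h3 : (-t⁻¹ * J) * t ^ (k + 1) = (-J) * t ^ k := by
        rw [pow_succ]; field_simp
      rw [h3]
      have h4 := mul_le_mul_of_nonneg_right (h1.trans h2) (pow_nonneg ht.1.le k)
      push_cast
      linarith
  have hIT : I T ≤ 0 := by
    -- Monotonicity compares scale T with every r < T, and η ≤ 1 supported in the unit ball bounds
    -- I(r) by the integral of f over the ball of radius r.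
    have h1 : ∀ᶠ r in 𝓝[>] (0 : ℝ), I T / T ^ (k + 1) ≤
        (r ^ (k + 1))⁻¹ * ∫ x in Metric.ball z r, f x := by
      filter_upwards [Ioo_mem_nhdsGT hT0] with r hr
      have hrR : r < R := hr.2.trans hTR
      refine (hanti ⟨hr.1, hrR⟩ ⟨hT0, hTR⟩ hr.2.le).trans ?_
      simp only
      rw [div_eq_inv_mul]
      refine mul_le_mul_of_nonneg_left ?_ (inv_nonneg.2 (pow_nonneg hr.1.le _))
      have h2 : ∫ x in Metric.ball z r, f x = ∫ x in B, (Metric.ball z r).indicator f x := by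
        rw [setIntegral_indicator measurableSet_ball,
          inter_eq_self_of_subset_right (Metric.ball_subset_ball hrR.le)]
      rw [h2]
      refine integral_mono_ae (hfh r hr.1) (hf.indicator measurableSet_ball)
        (Eventually.of_forall fun x => ?_)
      by_cases hx : x ∈ Metric.ball z r
      · simpa [hx] using mul_le_of_le_one_right (hf0 x) (hη1 _)
      · simp only [hx, not_false_eq_true, indicator_of_notMem]
        rw [hhz r hr.1 x (by simpa using hx), mul_zero]
    have h2 := ge_of_tendsto (hflat (k + 1)) h1
    rw [div_le_iff₀ (pow_pos hT0 _)] at h2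
    simpa using h2
  have h1 : (fun x => f x * η (T⁻¹ • (x - z))) =ᵐ[volume.restrict B] 0 :=
    (integral_eq_zero_iff_of_nonneg (fun x => mul_nonneg (hf0 x) (hη0 _)) (hfh T hT0)).1
      (le_antisymm hIT (hI0 T))
  have hsub : Metric.ball z (T / 2) ⊆ B := Metric.ball_subset_ball (by linarith)
  filter_upwards [ae_restrict_of_ae_restrict_of_subset hsub h1,
    ae_restrict_mem measurableSet_ball] with x hx hxB
  have h2 : η (T⁻¹ • (x - z)) = 1 := by
    refine hηo _ ?_
    rw [hnorm T hT0, div_le_iff₀ hT0]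
    have := (Metric.mem_ball.1 hxB).le
    linarith
  simpa [h2] using hx

/-! ### The radial inequality for |u|² -/

/-- Cauchy–Schwarz over pairs (j, k), applied to the rank-one matrix d_j v_k, whose Euclidean norm
factors. -/
theorem sum_mul_sum_le_norm_mul_gradientNorm {n M : ℕ} (d : EuclideanSpace ℝ (Fin n))
    (v : EuclideanSpace ℝ (Fin M)) (A : Matrix (Fin M) (Fin n) ℝ) :
    ∑ j, d j * ∑ k, v k * A k j ≤ ‖d‖ * ‖v‖ * gradientNorm A := by
  have h := Real.sum_mul_le_sqrt_mul_sqrt (Finset.univ : Finset (Fin n × Fin M))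
    (fun p => d p.1 * v p.2) (fun p => A p.2 p.1)
  rw [Fintype.sum_prod_type, Fintype.sum_prod_type, Fintype.sum_prod_type] at h
  have h1 : ∑ j, ∑ k, (d j * v k) ^ 2 = (‖d‖ * ‖v‖) ^ 2 := by
    rw [mul_pow, EuclideanSpace.real_norm_sq_eq, EuclideanSpace.real_norm_sq_eq,
      Finset.sum_mul_sum]
    simp only [mul_pow]
  simp only [h1] at h
  rw [Real.sqrt_sq (by positivity)] at h
  simp only [gradientNorm, sq_abs, Finset.mul_sum, ← mul_assoc]
  exact h

/-- The set of points near which `u` vanishes almost everywhere. -/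
def locallyNullSet {n M : ℕ} (u : EuclideanSpace ℝ (Fin n) → EuclideanSpace ℝ (Fin M)) :
    Set (EuclideanSpace ℝ (Fin n)) :=
  {x | ∃ r > 0, ∀ᵐ y ∂(volume.restrict (Metric.ball x r)), u y = 0}

section

variable {n M : ℕ} {Ω : Set (EuclideanSpace ℝ (Fin n))}
  {u : EuclideanSpace ℝ (Fin n) → EuclideanSpace ℝ (Fin M)}
  {Du : EuclideanSpace ℝ (Fin n) → Matrix (Fin M) (Fin n) ℝ} {C : ℝ}

/-- Unique continuation from a flat point to a ball on which `|x - z| ≤ |x|`. -/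
theorem ae_eq_zero_of_vanishesToInfiniteOrder (hΩ : IsOpen Ω) (hu : MemH1Loc u Ω)
    (hDu : HasWeakGradient Ω u Du) (hC : 0 < C)
    (h_ineq : ∀ᵐ x ∂(volume.restrict Ω), gradientNorm (Du x) ≤ C / ‖x‖ * ‖u x‖)
    {z : EuclideanSpace ℝ (Fin n)} {R T : ℝ} (hR : Metric.closedBall z R ⊆ Ω)
    (hz : ∀ x ∈ Metric.ball z R, ‖x - z‖ ≤ ‖x‖) (hflat : VanishesToInfiniteOrder u z)
    (hT0 : 0 < T) (hTR : T < R) :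
    ∀ᵐ x ∂(volume.restrict (Metric.ball z (T / 2))), u x = 0 := by
  have hBΩ : Metric.ball z R ⊆ Ω := Metric.ball_subset_closedBall.trans hR
  have hDu2 : ∀ k j, MemLpLoc (fun x => Du x k j) 2 Ω := by
    intro k j K hK hKc
    obtain ⟨g, hg, hg2⟩ := (hu k).2 j
    exact (memLp_congr_ae (ae_restrict_of_ae_restrict_of_subset hK
      (hg.ae_eq hΩ (hDu k j)))).1 (hg2 K hK hKc)
  have hm : ∀ {a : EuclideanSpace ℝ (Fin n) → ℝ}, MemLpLoc a 2 Ω →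
      MemLp a 2 (volume.restrict (Metric.ball z R)) := fun ha =>
    (ha _ hR (isCompact_closedBall z R)).mono_measure
      (Measure.restrict_mono Metric.ball_subset_closedBall le_rfl)
  have hi1 : ∀ k, IntegrableOn (fun x => u x k ^ 2) (Metric.ball z R) := fun k =>
    (hm (hu k).1).integrable_sq
  have hi2 : ∀ k j, IntegrableOn (fun x => 2 * u x k * Du x k j) (Metric.ball z R) := by
    intro k j
    have h1 : IntegrableOn (fun x => u x k * Du x k j) (Metric.ball z R) :=
      (hm (hu k).1).integrable_mul (hm (hDu2 k j))
    refine Integrable.congr (h1.const_mul 2) (Eventually.of_forall fun x => ?_)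
    simp only [mul_assoc]
  -- The 2 in A comes from differentiating the square.
  have key := ae_eq_zero_of_radial_derivative_le (z := z) (R := R) (A := 2 * C)
    (f := fun x => ∑ k, u x k ^ 2) (g := fun j x => ∑ k, 2 * u x k * Du x k j)
    (integrable_finsetSum _ fun k _ => hi1 k)
    (fun j => integrable_finsetSum _ fun k _ => hi2 k j)
    (fun x => Finset.sum_nonneg fun k _ => sq_nonneg _) ?_ ?_ ?_ hT0 hTR
  · filter_upwards [key] with x hx
    rw [← EuclideanSpace.real_norm_sq_eq] at hx
    simpa using hx
  · intro j φ hφ hφc hφB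
    have hφ' : Continuous fun x => fderiv ℝ φ x (EuclideanSpace.single j 1) :=
      (hφ.continuous_fderiv (by simp)).clm_apply continuous_const
    simp only [Finset.sum_mul]
    rw [integral_finsetSum _ fun k _ => (hi1 k).mul_of_hasCompactSupport hφ'
        (hφc.fderiv_apply ℝ _),
      integral_finsetSum _ fun k _ => (hi2 k j).mul_of_hasCompactSupport hφ.continuous hφc,
      ← Finset.sum_neg_distrib]
    refine Finset.sum_congr rfl fun k _ => ?_
    have h1 := (hDu k j).integral_sq hΩ (hu k).1 (hDu2 k j) hφ hφc (hφB.trans hBΩ)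
    have h2 : ∀ S, tsupport φ ⊆ S →
        ∫ x in S, u x k ^ 2 * fderiv ℝ φ x (EuclideanSpace.single j 1) =
          ∫ x, u x k ^ 2 * fderiv ℝ φ x (EuclideanSpace.single j 1) := fun S hS =>
      setIntegral_eq_integral_of_forall_compl_eq_zero fun x hx => by
        rw [image_eq_zero_of_notMem_tsupport
          (f := fun x => fderiv ℝ φ x (EuclideanSpace.single j 1))
          fun hx' => hx (hS (tsupport_fderiv_apply_subset ℝ _ hx')), mul_zero]
    have h3 : ∀ S, tsupport φ ⊆ S →
        ∫ x in S, 2 * u x k * Du x k j * φ x = ∫ x, 2 * u x k * Du x k j * φ x := fun S hS =>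
      setIntegral_eq_integral_of_forall_compl_eq_zero fun x hx => by
        rw [image_eq_zero_of_notMem_tsupport fun hx' => hx (hS hx'), mul_zero]
    rw [h2 _ hφB, h3 _ hφB, ← h2 _ (hφB.trans hBΩ), ← h3 _ (hφB.trans hBΩ), h1]
  · filter_upwards [ae_restrict_of_ae_restrict_of_subset hBΩ h_ineq,
      ae_restrict_mem measurableSet_ball] with x hx hxB
    have h1 := sum_mul_sum_le_norm_mul_gradientNorm (x - z) (u x) (Du x)
    have h2 : ∑ j, (x j - z j) * ∑ k, 2 * u x k * Du x k j =
        2 * ∑ j, (x - z) j * ∑ k, u x k * Du x k j := by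
      simp only [Finset.mul_sum, PiLp.sub_apply]
      exact Finset.sum_congr rfl fun j _ => Finset.sum_congr rfl fun k _ => by ring
    rw [h2, ← EuclideanSpace.real_norm_sq_eq]
    -- This also covers x = 0, where the quotient is 0 by convention.
    have h3 : ‖x - z‖ / ‖x‖ ≤ 1 := div_le_one_of_le₀ (hz x hxB) (norm_nonneg _)
    have h4 : ‖x - z‖ * ‖u x‖ * gradientNorm (Du x) ≤ C * ‖u x‖ ^ 2 := by
      calc _ ≤ ‖x - z‖ * ‖u x‖ * (C / ‖x‖ * ‖u x‖) := by gcongr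
        _ = (‖x - z‖ / ‖x‖) * (C * ‖u x‖ ^ 2) := by ring
        _ ≤ 1 * (C * ‖u x‖ ^ 2) := by gcongr
        _ = _ := one_mul _
    linarith
  · intro m
    simpa only [EuclideanSpace.real_norm_sq_eq] using hflat m

/-! ### Propagation of zeros through Ω -/

theorem isOpen_locallyNullSet : IsOpen (locallyNullSet u) := by
  refine Metric.isOpen_iff.2 fun x ⟨r, hr, h⟩ => ⟨r / 2, half_pos hr, fun y hy => ?_⟩
  refine ⟨r / 2, half_pos hr, ae_restrict_of_ae_restrict_of_subset ?_ h⟩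
  exact Metric.ball_subset_ball' (by linarith [Metric.mem_ball.1 hy])

theorem vanishesToInfiniteOrder_of_mem_locallyNullSet {z : EuclideanSpace ℝ (Fin n)}
    (hz : z ∈ locallyNullSet u) : VanishesToInfiniteOrder u z := by
  obtain ⟨r, hr, h⟩ := hz
  intro m
  refine tendsto_const_nhds.congr' ?_
  filter_upwards [Ioo_mem_nhdsGT hr] with t ht
  rw [integral_eq_zero_of_ae, mul_zero]
  filter_upwards [ae_restrict_of_ae_restrict_of_subset (Metric.ball_subset_ball ht.2.le) h]
    with x hx
  simp [hx]

theorem ae_eq_zero_of_subset_locallyNullSet {S : Set (EuclideanSpace ℝ (Fin n))}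
    (hS : S ⊆ locallyNullSet u) : ∀ᵐ x, x ∈ S → u x = 0 := by
  have h : volume {x | x ∈ S ∧ u x ≠ 0} = 0 := by
    refine measure_null_of_locally_null _ fun x hx => ?_
    obtain ⟨r, hr, h⟩ := hS hx.1
    refine ⟨{y | y ∈ Metric.ball x r ∧ u y ≠ 0}, ?_, ?_⟩
    · filter_upwards [mem_nhdsWithin_of_mem_nhds (Metric.ball_mem_nhds x hr),
        self_mem_nhdsWithin] with y hy hyS using ⟨hy, hyS.2⟩
    · rw [ae_restrict_iff' measurableSet_ball, ae_iff] at h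
      simpa using h
  rw [ae_iff]
  simpa using h

theorem isPreconnected_ball_diff_center {E : Type*} [NormedAddCommGroup E] [NormedSpace ℝ E]
    (h : 1 < Module.rank ℝ E) (δ : ℝ) : IsPreconnected (Metric.ball (0 : E) δ \ {0}) := by
  have h1 : Metric.ball (0 : E) δ \ {0} =
      (fun p : ℝ × E => p.1 • p.2) '' (Ioo 0 δ ×ˢ Metric.sphere (0 : E) 1) := by
    ext x
    constructor
    · rintro ⟨hx, hx0⟩
      have hx0' : x ≠ 0 := hx0
      have h2 : 0 < ‖x‖ := norm_pos_iff.2 hx0'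
      refine ⟨(‖x‖, ‖x‖⁻¹ • x), ⟨⟨h2, by simpa using hx⟩, ?_⟩, ?_⟩
      · simp [norm_smul, h2.ne']
      · simp [smul_smul, h2.ne']
    · rintro ⟨⟨r, y⟩, ⟨⟨hr0, hr⟩, hy⟩, rfl⟩
      simp only at hr0 hr
      have hy1 : ‖y‖ = 1 := by simpa using hy
      have hy0 : y ≠ 0 := by rintro rfl; simp at hy1
      refine ⟨?_, ?_⟩
      · simpa [norm_smul, hy1, abs_of_pos hr0] using hr
      · simpa using ⟨hr0.ne', hy0⟩
  rw [h1]
  exact (isPreconnected_Ioo.prod (isPreconnected_sphere h 0 1)).image _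
    continuous_smul.continuousOn

theorem mem_locallyNullSet_of_vanishesToInfiniteOrder (hΩ : IsOpen Ω) (hu : MemH1Loc u Ω)
    (hDu : HasWeakGradient Ω u Du) (hC : 0 < C)
    (h_ineq : ∀ᵐ x ∂(volume.restrict Ω), gradientNorm (Du x) ≤ C / ‖x‖ * ‖u x‖)
    {z : EuclideanSpace ℝ (Fin n)} (hz : z ∈ Ω) (hflat : VanishesToInfiniteOrder u z) :
    z ∈ locallyNullSet u := by
  obtain ⟨δ, hδ, hδΩ⟩ := Metric.nhds_basis_closedBall.mem_iff.1 (hΩ.mem_nhds hz)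
  obtain ⟨R, hR0, hRδ, hR⟩ : ∃ R > 0, R ≤ δ ∧ ∀ x ∈ Metric.ball z R, ‖x - z‖ ≤ ‖x‖ := by
    by_cases hz0 : z = 0
    · exact ⟨δ, hδ, le_rfl, fun x _ => by simp [hz0]⟩
    · have h1 := norm_pos_iff.2 hz0
      -- If |x - z| < |z|/2, then |x| > |z|/2 > |x - z|.
      refine ⟨min δ (‖z‖ / 2), lt_min hδ (by positivity), min_le_left _ _, fun x hx => ?_⟩
      have h2 := (mem_ball_iff_norm.1 hx).trans_le (min_le_right _ _)
      have h3 := norm_sub_norm_le z x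
      rw [norm_sub_rev] at h3
      linarith
  exact ⟨R / 2 / 2, by positivity, ae_eq_zero_of_vanishesToInfiniteOrder hΩ hu hDu hC h_ineq
    ((Metric.closedBall_subset_closedBall hRδ).trans hδΩ) hR hflat (half_pos hR0)
    (half_lt_self hR0)⟩

/-- A nearby point z of the null set is flat, and the radius of vanishing about z depends only on x,
so the resulting ball contains a neighbourhood of x. -/
theorem mem_locallyNullSet_of_mem_closure (hΩ : IsOpen Ω) (hu : MemH1Loc u Ω)
    (hDu : HasWeakGradient Ω u Du) (hC : 0 < C)
    (h_ineq : ∀ᵐ x ∂(volume.restrict Ω), gradientNorm (Du x) ≤ C / ‖x‖ * ‖u x‖)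
    {x : EuclideanSpace ℝ (Fin n)} (hx : x ∈ Ω) (hx0 : x ≠ 0)
    (hxc : x ∈ closure (locallyNullSet u)) : x ∈ locallyNullSet u := by
  obtain ⟨δ', hδ', hδΩ'⟩ := Metric.nhds_basis_closedBall.mem_iff.1 (hΩ.mem_nhds hx)
  obtain ⟨δ, hδ, hδx, hδΩ⟩ : ∃ δ > 0, δ ≤ ‖x‖ / 2 ∧ Metric.closedBall x δ ⊆ Ω :=
    ⟨min δ' (‖x‖ / 2), lt_min hδ' (half_pos (norm_pos_iff.2 hx0)), min_le_right _ _,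
      (Metric.closedBall_subset_closedBall (min_le_left _ _)).trans hδΩ'⟩
  obtain ⟨z, hz, hxz⟩ := Metric.mem_closure_iff.1 hxc (δ / 8) (by positivity)
  have hzx : ‖x - z‖ < δ / 8 := by rwa [← dist_eq_norm]
  -- On the ball of radius δ/2 about z, |y| ≥ |x| - |x - y| > 2δ - 5δ/8 > δ/2 > |y - z|. Vanishing
  -- holds within T/2 = δ/6 = δ/24 + δ/8 of z, hence within δ/24 of x.
  have h := ae_eq_zero_of_vanishesToInfiniteOrder (T := δ / 3) (R := δ / 2) (z := z) hΩ hu hDu hC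
    h_ineq
    ((Metric.closedBall_subset_closedBall' (by rw [dist_comm]; linarith)).trans hδΩ)
    (fun y hy => by
      have h1 := mem_ball_iff_norm.1 hy
      have h2 := norm_sub_norm_le x y
      have h3 := norm_sub_le_norm_sub_add_norm_sub x z y
      rw [norm_sub_rev z y] at h3
      linarith)
    (vanishesToInfiniteOrder_of_mem_locallyNullSet hz) (by linarith) (by linarith)
  exact ⟨δ / 24, by positivity, ae_restrict_of_ae_restrict_of_subset
    (Metric.ball_subset_ball' (by linarith)) h⟩

theorem zero_mem_locallyNullSet_of_mem_closure (hn : 2 ≤ n) (hΩ : IsOpen Ω) (hu : MemH1Loc u Ω)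
    (hDu : HasWeakGradient Ω u Du) (hC : 0 < C)
    (h_ineq : ∀ᵐ x ∂(volume.restrict Ω), gradientNorm (Du x) ≤ C / ‖x‖ * ‖u x‖)
    (h0 : (0 : EuclideanSpace ℝ (Fin n)) ∈ Ω) (h0c : 0 ∈ closure (locallyNullSet u)) :
    0 ∈ locallyNullSet u := by
  obtain ⟨δ, hδ, hδΩ⟩ := Metric.isOpen_iff.1 hΩ 0 h0
  have : Nontrivial (EuclideanSpace ℝ (Fin n)) :=
    Module.nontrivial_of_finrank_pos (R := ℝ) (by rw [finrank_euclideanSpace_fin]; omega)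
  have hrank : 1 < Module.rank ℝ (EuclideanSpace ℝ (Fin n)) :=
    Module.one_lt_rank_of_one_lt_finrank (by rw [finrank_euclideanSpace_fin]; omega)
  have h1 : (Metric.ball 0 δ ∩ locallyNullSet u).Nonempty :=
    mem_closure_iff_nhds.1 h0c _ (Metric.ball_mem_nhds 0 hδ)
  -- The null set is open, so it meets the ball at some point other than 0.
  obtain ⟨y, ⟨hyB, hyN⟩, hy0⟩ :=
    (dense_compl_singleton (0 : EuclideanSpace ℝ (Fin n))).inter_open_nonempty _ (Metric.isOpen_ball.inter isOpen_locallyNullSet) h1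
  have h2 : Metric.ball 0 δ \ {0} ⊆ locallyNullSet u :=
    (isPreconnected_ball_diff_center hrank δ).subset_of_closure_inter_subset
      isOpen_locallyNullSet ⟨y, ⟨hyB, hy0⟩, hyN⟩ fun x hx =>
        mem_locallyNullSet_of_mem_closure hΩ hu hDu hC h_ineq (hδΩ hx.2.1) hx.2.2 hx.1
  refine ⟨δ, hδ, ?_⟩
  rw [ae_restrict_iff' measurableSet_ball]
  filter_upwards [ae_eq_zero_of_subset_locallyNullSet h2, Measure.ae_ne volume 0] with x hx hx0 hxB
  exact hx ⟨hxB, hx0⟩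

end

theorem mainTheorem5 (n M : ℕ) (hn : 1 ≤ n)
    (Ω : Set (EuclideanSpace ℝ (Fin n))) (hΩ_open : IsOpen Ω) (hΩ_conn : IsConnected Ω)
    (u : EuclideanSpace ℝ (Fin n) → EuclideanSpace ℝ (Fin M)) (hu : MemH1Loc u Ω)
    (Du : EuclideanSpace ℝ (Fin n) → Matrix (Fin M) (Fin n) ℝ) (hDu : HasWeakGradient Ω u Du)
    (C : ℝ) (hC : 0 < C)
    (h_ineq : ∀ᵐ x ∂(volume.restrict Ω), gradientNorm (Du x) ≤ C / ‖x‖ * ‖u x‖)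
    (x₀ : EuclideanSpace ℝ (Fin n)) (hx₀ : x₀ ∈ Ω)
    (h_one : n = 1 → (0 : EuclideanSpace ℝ (Fin n)) ∈ Ω → x₀ = 0)
    (h_flat : VanishesToInfiniteOrder u x₀) :
    ∀ᵐ x ∂(volume.restrict Ω), u x = 0 := by
  have h1 : x₀ ∈ locallyNullSet u :=
    mem_locallyNullSet_of_vanishesToInfiniteOrder hΩ_open hu hDu hC h_ineq hx₀ h_flat
  have h2 : Ω ⊆ locallyNullSet u := by
    refine hΩ_conn.isPreconnected.subset_of_closure_inter_subset isOpen_locallyNullSet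
      ⟨x₀, hx₀, h1⟩ fun x hx => ?_
    by_cases hx0 : x = 0
    · subst hx0
      rcases hn.eq_or_lt with hn1 | hn2
      -- For n = 1 the point 0 is x₀ itself.
      · rwa [← h_one hn1.symm hx.2]
      · exact zero_mem_locallyNullSet_of_mem_closure hn2 hΩ_open hu hDu hC h_ineq hx.2 hx.1
    · exact mem_locallyNullSet_of_mem_closure hΩ_open hu hDu hC h_ineq hx.2 hx0 hx.1
  rw [ae_restrict_iff' hΩ_open.measurableSet]
  exact ae_eq_zero_of_subset_locallyNullSet h2
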